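/- Let $A$ be a finite set with $|A|>2$. Operations on $A$ are functions $A^n\to A$ with $n\ge 1$, and a clone on $A$ is a set of operations on $A$ that contains all projections and is closed under composition; clones are ordered by inclusion. For a clone $\mathcal C$ on $A$, an $n$-ary operation $f$ is a $\mathcal C$-minor of an $m$-ary operation $g$ if $f=g(h_1,\dots,h_m)$ for some $n$-ary $h_1,\dots,h_m\in\mathcal C$, and $f,g$ are $\mathcal C$-equivalent if each is a $\mathcal C$-minor of the other. Let $\mathfrak F_A$ be the family of all clones $\mathcal C$ on $A$ for which there are only finitely many $\mathcal C$-equivalence classes of operations on $A$. Let $\mathcal D$ be the clone generated by the discriminator function $t$ on $A$, where $t(x,y,z)=z$ if $x=y$ and $t(x,y,z)=x$ otherwise. Then for every proper subclone $\mathcal H$ of $\mathcal D$ there are infinitely many $\mathcal H$-equivalence classes of operations on $A$. Moreover, $\mathfrak F_A$ is an order filter, that is, a nonempty family such that every clone on $A$ containing a member of $\mathfrak F_A$ is in $\mathfrak F_A$; $\mathcal D$ is a minimal member of $\mathfrak F_A$ (in particular $\mathcal D\in\mathfrak F_A$); and $\mathfrak F_A$ is not principal, that is, there is no clone $\mathcal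 C$ on $A$ such that $\mathfrak F_A$ consists of exactly the clones on $A$ that contain $\mathcal C$. -/

import Mathlib

/-- The `n`-ary operations on `A`. -/
abbrev OpN (A : Type*) (n : ℕ+) : Type _ := (Fin n → A) → A

/-- The set of all finitary operations (of positive arity) on `A`; an element is a pair
`⟨n, f⟩` with `f` an `n`-ary operation. -/
abbrev Operation (A : Type*) : Type _ := Σ n : ℕ+, OpN A n

/-- The composition `g ∘ (h₁, …, hₘ)` of an `m`-ary operation with an `m`-tuple of `n`-ary
operations. -/
def OpN.comp {A : Type*} {m n : ℕ+} (g : OpN A m) (h : Fin m → OpN A n) : OpN A n :=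
  fun a => g (fun i => h i a)

/-- The `i`-th `n`-ary projection. -/
def OpN.proj (A : Type*) (n : ℕ+) (i : Fin n) : OpN A n := fun a => a i

/-- A clone on `A`: a set of operations that contains the projections and is closed under
composition. -/
@[ext]
structure OpClone (A : Type*) where
  carrier : Set (Operation A)
  proj_mem : ∀ (n : ℕ+) (i : Fin n), (⟨n, OpN.proj A n i⟩ : Operation A) ∈ carrier
  comp_mem : ∀ (m n : ℕ+) (g : OpN A m) (h : Fin m → OpN A n),
    (⟨m, g⟩ : Operation A) ∈ carrier → (∀ i, (⟨n, h i⟩ : Operation A) ∈ carrier) →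
      (⟨n, g.comp h⟩ : Operation A) ∈ carrier

namespace OpClone

/-- Clones are ordered by inclusion. -/
instance {A : Type*} : PartialOrder (OpClone A) :=
  PartialOrder.lift OpClone.carrier (fun _ _ h => OpClone.ext h)

/-- The clone generated by a set `F` of operations: the smallest clone containing `F`, given as
the intersection of all clones that contain `F`. -/
def generate {A : Type*} (F : Set (Operation A)) : OpClone A where
  carrier := {f | ∀ C : OpClone A, F ⊆ C.carrier → f ∈ C.carrier}
  proj_mem := fun n i C _ => C.proj_mem n i
  comp_mem := fun m n g h hg hh C hC =>
    C.comp_mem m n g h (hg C hC) (fun i => hh i C hC)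

/-- `C.Minor f g`: the operation `f` is a `C`-minor of `g`, i.e. `f = g ∘ h` for some tuple `h`
of operations from `C`. -/
def Minor {A : Type*} (C : OpClone A) (f g : Operation A) : Prop :=
  ∃ h : Fin g.1 → OpN A f.1,
    (∀ i, (⟨f.1, h i⟩ : Operation A) ∈ C.carrier) ∧ f.2 = g.2.comp h

theorem Minor.refl {A : Type*} (C : OpClone A) (f : Operation A) : C.Minor f f :=
  ⟨fun i => OpN.proj A f.1 i, fun i => C.proj_mem f.1 i, rfl⟩

theorem Minor.trans {A : Type*} {C : OpClone A} {f g k : Operation A}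
    (hfg : C.Minor f g) (hgk : C.Minor g k) : C.Minor f k := by
  obtain ⟨h, hC, hf⟩ := hfg
  obtain ⟨h', hC', hg⟩ := hgk
  refine ⟨fun i => (h' i).comp h, fun i => C.comp_mem _ _ _ _ (hC' i) hC, ?_⟩
  rw [hf, hg]
  rfl

/-- `C`-equivalence of operations: each one is a `C`-minor of the other. -/
def equivalence {A : Type*} (C : OpClone A) : Setoid (Operation A) where
  r f g := C.Minor f g ∧ C.Minor g f
  iseqv :=
    { refl := fun f => ⟨Minor.refl C f, Minor.refl C f⟩
      symm := fun h => ⟨h.2, h.1⟩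
      trans := fun h k => ⟨h.1.trans k.1, k.2.trans h.2⟩ }

/-- The set of `C`-equivalence classes of operations on `A`. -/
abbrev Classes {A : Type*} (C : OpClone A) : Type _ := Quotient C.equivalence

/-- The family of all clones on `A` with only finitely many equivalence classes of operations. -/
def finiteIndex (A : Type*) : Set (OpClone A) := {C | Finite C.Classes}

end OpClone

open Classical in
/-- The discriminator function on `A`: `t(x, y, z) = z` if `x = y`, and `x` otherwise. -/
noncomputable def discriminator (A : Type*) : OpN A 3 :=
  fun a : Fin 3 → A => if a 0 = a 1 then a 2 else a 0

/-- The clone generated by the discriminator function on `A`. -/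
noncomputable def discriminatorClone (A : Type*) : OpClone A :=
  OpClone.generate {(⟨3, discriminator A⟩ : Operation A)}

/-! ### Minors and equivalence classes for an arbitrary clone -/

namespace OpClone

variable {A : Type*}

/-! The discriminator clone D consists of the pattern functions. Being a D-minor can thus be tested
one equality pattern at a time, and for finite `A` the data involved take finitely many values.

Pattern functions commute with injections, so a clone H < D induces one Boolean clone on all
two-element subsets. If that clone had a Pixley operation, a lift of it would generate the
discriminator and H would be D. Otherwise the induced operations are all monotone or all linear over
the two-element field. Monotone maps send a chain of n + 1 Boolean tuples to a chain, so n-ary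
parity is no minor of an operation of arity below n. A linear map to a smaller dimension has a
kernel, so n-ary conjunction is no such minor either.

Słupecki's clone also has finitely many classes, by Jablonskii's lemma, but omits the discriminator.
A least member of the filter would equal D by minimality and lie below Słupecki's clone, which is
impossible. -/

theorem comp_three_mem (C : OpClone A) {n : ℕ+} {g : OpN A 3} {h₀ h₁ h₂ : OpN A n}
    (hg : (⟨3, g⟩ : Operation A) ∈ C.carrier) (m₀ : (⟨n, h₀⟩ : Operation A) ∈ C.carrier)
    (m₁ : (⟨n, h₁⟩ : Operation A) ∈ C.carrier) (m₂ : (⟨n, h₂⟩ : Operation A) ∈ C.carrier) :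
    (⟨n, fun a => g ![h₀ a, h₁ a, h₂ a]⟩ : Operation A) ∈ C.carrier := by
  have key := C.comp_mem 3 n g (![h₀, h₁, h₂] : Fin 3 → OpN A n) hg (by
    intro i
    change Fin 3 at i
    fin_cases i <;> assumption)
  convert key using 2
  funext a
  refine congrArg g ?_
  funext i
  change Fin 3 at i
  fin_cases i <;> rfl

/-- If an invariant with finitely many values controls the minor relation, then there are only
finitely many classes. -/
theorem finite_classes_of_invariant {C : OpClone A} {β : Type*} [Finite β]
    (I : Operation A → β) (hI : ∀ f g, I f = I g → C.Minor f g) : Finite C.Classes := by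
  refine Finite.of_injective (fun q : C.Classes => I q.out) fun p q hpq => ?_
  rw [← Quotient.out_eq p, ← Quotient.out_eq q]
  exact Quotient.sound ⟨hI _ _ hpq, hI _ _ hpq.symm⟩

/-- If there are operations that are not minors of operations of small arity, then there are
infinitely many classes. -/
theorem infinite_classes_of_arity {C : OpClone A}
    (h : ∀ N : ℕ, ∃ f : Operation A, ∀ g, C.Minor f g → N < (g.1 : ℕ)) :
    Infinite C.Classes := by
  by_contra hfin
  rw [not_infinite_iff_finite] at hfin
  obtain ⟨N, hN⟩ := (Set.finite_range fun q : C.Classes => (q.out.1 : ℕ)).bddAbove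
  obtain ⟨f, hf⟩ := h N
  have hout : C.equivalence (Quotient.mk _ f : C.Classes).out f :=
    Quotient.exact (Quotient.out_eq _)
  exact absurd (hf _ hout.2) (not_lt.2 (hN ⟨_, rfl⟩))

theorem isUpperSet_finiteIndex : IsUpperSet (finiteIndex A) := by
  intro C D hCD (hC : Finite C.Classes)
  have hmono : ∀ f g, C.Minor f g → D.Minor f g :=
    fun f g ⟨h, hh, e⟩ => ⟨h, fun i => hCD (hh i), e⟩
  refine Finite.of_surjective
    (Quotient.map' id (fun f g h => ⟨hmono _ _ h.1, hmono _ _ h.2⟩) : C.Classes → D.Classes) ?_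
  intro q
  induction q using Quotient.inductionOn with
  | h f => exact ⟨Quotient.mk _ f, rfl⟩

end OpClone

/-! ### Pattern functions and the discriminator clone -/

section Pattern

variable {A : Type*}

/-- A pattern function: the value is the argument at a position that depends only on which of the
arguments are equal. -/
def IsPattern {n : ℕ+} (f : OpN A n) : Prop :=
  ∃ J : Setoid (Fin n) → Fin n, ∀ a, f a = a (J (Setoid.ker a))

theorem Setoid.ker_comp_of_injective {α β γ : Type*} {e : β → γ} (he : Function.Injective e)
    (u : α → β) : Setoid.ker (e ∘ u) = Setoid.ker u := by
  ext i j
  simp [Setoid.ker_def, he.eq_iff]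

/-- The clone of all pattern functions. -/
def patternClone (A : Type*) : OpClone A where
  carrier := {f | IsPattern f.2}
  proj_mem := fun n i => ⟨fun _ => i, fun _ => rfl⟩
  comp_mem := by
    rintro m n g h ⟨J, hJ⟩ hh
    choose L hL using hh
    refine ⟨fun K => L (J (K.comap fun i => L i K)) K, fun a => ?_⟩
    refine (hJ fun i => h i a).trans ?_
    have hk : Setoid.ker (fun i => h i a) =
        (Setoid.ker a).comap fun i => L i (Setoid.ker a) := by
      ext i j
      change h i a = h j a ↔ a _ = a _
      have hi : h i a = _ := hL i a
      have hj : h j a = _ := hL j a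
      rw [hi, hj]
    rw [hk]
    exact hL _ a

theorem discriminator_isPattern : IsPattern (discriminator A) := by
  classical
  refine ⟨fun K : Setoid (Fin 3) => if K 0 1 then (2 : Fin 3) else (0 : Fin 3), fun a => ?_⟩
  have hker : Setoid.ker a (0 : Fin 3) (1 : Fin 3) ↔ a (0 : Fin 3) = a (1 : Fin 3) := Iff.rfl
  change (if a (0 : Fin 3) = a (1 : Fin 3) then a (2 : Fin 3) else a (0 : Fin 3)) = _
  by_cases h : a (0 : Fin 3) = a (1 : Fin 3)
  · exact (if_pos h).trans (congrArg a (if_pos (hker.2 h)).symm)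
  · exact (if_neg h).trans (congrArg a (if_neg (mt hker.1 h)).symm)

theorem discriminator_mem_discriminatorClone :
    (⟨3, discriminator A⟩ : Operation A) ∈ (discriminatorClone A).carrier :=
  fun _ hC => hC rfl

theorem discriminatorClone_le {C : OpClone A}
    (h : (⟨3, discriminator A⟩ : Operation A) ∈ C.carrier) : discriminatorClone A ≤ C :=
  fun _ hf => hf C (Set.singleton_subset_iff.2 h)

theorem discriminatorClone_le_patternClone : discriminatorClone A ≤ patternClone A :=
  discriminatorClone_le discriminator_isPattern

theorem discriminator_apply [DecidableEq A] (x y z : A) :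
    discriminator A (![x, y, z] : Fin 3 → A) = if x = y then z else x := by
  simp only [discriminator]
  congr

open Classical in
/-- A clone containing the discriminator is closed under definition by cases. -/
theorem cases_mem {C : OpClone A} (ht : (⟨3, discriminator A⟩ : Operation A) ∈ C.carrier)
    {n : ℕ+} {f₁ f₂ f₃ f₄ : OpN A n} (h₁ : (⟨n, f₁⟩ : Operation A) ∈ C.carrier)
    (h₂ : (⟨n, f₂⟩ : Operation A) ∈ C.carrier) (h₃ : (⟨n, f₃⟩ : Operation A) ∈ C.carrier)
    (h₄ : (⟨n, f₄⟩ : Operation A) ∈ C.carrier) :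
    (⟨n, fun a => if f₁ a = f₂ a then f₃ a else f₄ a⟩ : Operation A) ∈ C.carrier := by
  -- This is t(t(f₁,f₂,f₃), t(f₁,f₂,f₄), f₄): it equals t(f₃,f₄,f₄) = f₃ if f₁ = f₂, and t(f₁,f₁,f₄)
  -- = f₄ otherwise.
  have key := C.comp_three_mem ht (C.comp_three_mem ht h₁ h₂ h₃) (C.comp_three_mem ht h₁ h₂ h₄) h₄
  convert key using 2
  funext a
  simp only [discriminator_apply]
  by_cases h : f₁ a = f₂ a
  · simp +contextual [h]
  · simp [h]

open Classical in
theorem decision_mem {C : OpClone A} (ht : (⟨3, discriminator A⟩ : Operation A) ∈ C.carrier)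
    {n : ℕ+} (S : Finset (Fin n × Fin n)) (J : Finset (Fin n × Fin n) → Fin n) :
    (⟨n, fun a => a (J (S.filter fun p => a p.1 = a p.2))⟩ : Operation A) ∈ C.carrier := by
  induction S using Finset.induction_on generalizing J with
  | empty => exact C.proj_mem n (J ∅)
  | insert p S hp ih =>
    have key := cases_mem ht (C.proj_mem n p.1) (C.proj_mem n p.2) (ih fun T => J (insert p T)) (ih J)
    convert key using 2
    funext a
    simp only [OpN.proj, Finset.filter_insert]
    by_cases h : a p.1 = a p.2 <;> simp [h]

/-- A decision tree over all pairs of positions determines the kernel, recovered as the least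
equivalence relation containing the pairs found equal. -/
theorem patternClone_le_discriminatorClone : patternClone A ≤ discriminatorClone A := by
  classical
  rintro ⟨n, f⟩ ⟨J, hJ⟩
  have key := decision_mem (discriminator_mem_discriminatorClone (A := A)) (n := n) Finset.univ
    fun T => J (sInf {K | ∀ i j, (i, j) ∈ T → K i j})
  convert key using 2
  funext a
  refine (hJ a).trans (congrArg (fun K => a (J K)) ?_)
  apply le_antisymm
  · refine le_sInf fun K hK i j hij => hK i j ?_
    simpa using hij
  · exact sInf_le fun i j hij => by simpa using hij

/-- The discriminator clone has finitely many classes: the class of `f` is determined by the set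
of all functions `σ ↦ f (σ ∘ p)` together with the ranges of the tuples `p`. -/
theorem discriminatorClone_mem_finiteIndex [Finite A] :
    discriminatorClone A ∈ OpClone.finiteIndex A := by
  refine OpClone.finite_classes_of_invariant (β := Set (Set A × ((A → A) → A)))
    (fun f => Set.range fun p : Fin f.1 → A => (Set.range p, fun σ : A → A => f.2 (σ ∘ p))) ?_
  rintro ⟨n, f⟩ ⟨m, g⟩ hfg
  have hsub : ∀ a : Fin n → A, ∃ j : Fin m → Fin n, ∀ σ : A → A, f (σ ∘ a) = g (σ ∘ a ∘ j) := by
    intro a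
    have hmem : (Set.range a, fun σ : A → A => f (σ ∘ a)) ∈
        Set.range fun p : Fin m → A => (Set.range p, fun σ : A → A => g (σ ∘ p)) := by
      have := hfg.subset ⟨a, rfl⟩
      exact this
    obtain ⟨p, hp⟩ := hmem
    obtain ⟨hr, hF⟩ := Prod.mk.inj hp
    have : ∀ i, ∃ k, a k = p i := fun i => hr.subset ⟨i, rfl⟩
    choose j hj using this
    obtain rfl : a ∘ j = p := funext hj
    exact ⟨j, fun σ => (congrFun hF σ).symm⟩
  choose j hj using hsub
  -- One tuple with kernel `K` serves all others: any `b` with that kernel is σ ∘ a for some σ.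
  -- Kernels not realized in `A` get a dummy choice.
  have hK : ∀ K : Setoid (Fin n), ∃ j : Fin m → Fin n,
      ∀ b : Fin n → A, Setoid.ker b = K → f b = g (b ∘ j) := by
    intro K
    by_cases hex : ∃ a : Fin n → A, Setoid.ker a = K
    · obtain ⟨a, rfl⟩ := hex
      refine ⟨j a, fun b hb => ?_⟩
      have hfac : Function.FactorsThrough b a := fun x y hxy => by
        have : Setoid.ker b x y := by rw [hb]; exact hxy
        exact this
      have hext : Function.extend a b id ∘ a = b := hfac.extend_comp id
      have := hj a (Function.extend a b id)
      rwa [← Function.comp_assoc, hext] at this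
    · exact ⟨fun _ => ⟨0, n.pos⟩, fun b hb => absurd ⟨b, hb⟩ hex⟩
  choose L hL using hK
  refine ⟨fun i a => a (L (Setoid.ker a) i), fun i => ?_, funext fun a => hL _ a rfl⟩
  exact patternClone_le_discriminatorClone ⟨fun K => L K i, fun a => rfl⟩

end Pattern

/-! ### Proper subclones, via the induced Boolean clone -/

section TwoElements

variable {A : Type*}

theorem IsPattern.map_comp {n : ℕ+} {f : OpN A n} (hf : IsPattern f) {σ : A → A}
    (hσ : Function.Injective σ) (a : Fin n → A) : f (σ ∘ a) = σ (f a) := by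
  obtain ⟨J, hJ⟩ := hf
  rw [hJ, hJ, Setoid.ker_comp_of_injective hσ]
  rfl

theorem IsPattern.map_const {n : ℕ+} {f : OpN A n} (hf : IsPattern f) (x : A) :
    f (fun _ => x) = x := by
  obtain ⟨J, hJ⟩ := hf
  rw [hJ]

theorem exists_eq_vec_three (a : Fin 3 → A) : ∃ x y z, a = ![x, y, z] :=
  ⟨a 0, a 1, a 2, by funext i; fin_cases i <;> rfl⟩

theorem comp_vec_three {B : Type*} (e : A → B) (x y z : A) :
    e ∘ ![x, y, z] = ![e x, e y, e z] := by
  funext i; fin_cases i <;> rfl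

theorem vec_three_const (x : A) : (![x, x, x] : Fin 3 → A) = fun _ => x := by
  funext i; fin_cases i <;> rfl

theorem IsPattern.map_vec_const {f : OpN A 3} (hf : IsPattern f) (x : A) : f ![x, x, x] = x :=
  (congrArg f (vec_three_const x)).trans (hf.map_const x)

theorem IsPattern.map_vec_not {f : OpN Bool 3} (hf : IsPattern f) (x y z : Bool) :
    f ![!x, !y, !z] = !f ![x, y, z] :=
  (congrArg f (comp_vec_three not x y z).symm).trans (hf.map_comp Bool.not_injective _)

/-- The operations induced by a clone on two-element subsets, provided that these do not depend on
the subset and its enumeration. -/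
def restrictBool (C : OpClone A) : OpClone Bool where
  carrier := {u | ∃ f : OpN A u.1, (⟨u.1, f⟩ : Operation A) ∈ C.carrier ∧
    ∀ e : Bool → A, Function.Injective e → ∀ b, f (e ∘ b) = e (u.2 b)}
  proj_mem := fun n i => ⟨OpN.proj A n i, C.proj_mem n i, fun _ _ _ => rfl⟩
  comp_mem := by
    rintro m n g h ⟨f, hf, hfe⟩ hh
    choose k hk hke using hh
    refine ⟨f.comp k, C.comp_mem m n f k hf hk, fun e he b => ?_⟩
    have : (fun i => k i (e ∘ b)) = e ∘ fun i => h i b := funext fun i => hke i e he b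
    exact (congrArg f this).trans (hfe e he _)

theorem restrictBool_le_patternClone [Nontrivial A] {C : OpClone A} (hC : C ≤ patternClone A) :
    restrictBool C ≤ patternClone Bool := by
  rintro ⟨n, u⟩ ⟨f, hf, hfe⟩
  obtain ⟨J, hJ⟩ := hC hf
  obtain ⟨x, y, hxy⟩ := exists_pair_ne A
  have he : Function.Injective fun b : Bool => cond b x y := by
    rintro (_ | _) (_ | _) h <;> simp_all [eq_comm]
  refine ⟨J, fun b => he ?_⟩
  refine (hfe _ he b).symm.trans ((hJ _).trans ?_)
  rw [Setoid.ker_comp_of_injective he]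
  rfl

theorem exists_mem_restrictBool {C : OpClone A} (hC : C ≤ patternClone A) {n : ℕ+} {f : OpN A n}
    (hf : (⟨n, f⟩ : Operation A) ∈ C.carrier) :
    ∃ u : OpN Bool n, (⟨n, u⟩ : Operation Bool) ∈ (restrictBool C).carrier ∧
      ∀ e : Bool → A, Function.Injective e → ∀ b, f (e ∘ b) = e (u b) := by
  obtain ⟨J, hJ⟩ := hC hf
  have key : ∀ e : Bool → A, Function.Injective e → ∀ b : Fin n → Bool,
      f (e ∘ b) = e (b (J (Setoid.ker b))) := by
    intro e he b
    refine (hJ _).trans ?_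
    rw [Setoid.ker_comp_of_injective he]
    rfl
  exact ⟨fun b => b (J (Setoid.ker b)), ⟨f, hf, key⟩, key⟩

/-- Pixley operations: `p(x,x,y) = y`, `p(x,y,x) = x` and `p(x,y,y) = x`. -/
def IsPixley (p : OpN A 3) : Prop :=
  ∀ x y : A, p ![x, x, y] = y ∧ p ![x, y, x] = x ∧ p ![x, y, y] = x

/-- Boolean pattern functions fix constants and commute with negation, so three values determine a
ternary one. -/
theorem isPixley_of_values {p : OpN Bool 3} (hp : IsPattern p)
    (h₁ : p ![false, false, true] = true) (h₂ : p ![false, true, false] = false)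
    (h₃ : p ![false, true, true] = false) : IsPixley p := by
  have n₁ := hp.map_vec_not false false true
  have n₂ := hp.map_vec_not false true false
  have n₃ := hp.map_vec_not false true true
  have c := hp.map_vec_const
  rw [h₁] at n₁
  rw [h₂] at n₂
  rw [h₃] at n₃
  rintro (_ | _) (_ | _)
  · exact ⟨c _, c _, c _⟩
  · exact ⟨h₁, h₂, h₃⟩
  · exact ⟨n₁, n₂, n₃⟩
  · exact ⟨c _, c _, c _⟩

theorem isMinority_of_values {p : OpN Bool 3} (hp : IsPattern p)
    (h₁ : p ![false, false, true] = true) (h₂ : p ![false, true, false] = true)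
    (h₃ : p ![false, true, true] = false) : ∀ x y z, p ![x, y, z] = (x ^^ y ^^ z) := by
  have n₁ := hp.map_vec_not false false true
  have n₂ := hp.map_vec_not false true false
  have n₃ := hp.map_vec_not false true true
  have c := hp.map_vec_const
  rw [h₁] at n₁
  rw [h₂] at n₂
  rw [h₃] at n₃
  rintro (_ | _) (_ | _) (_ | _)
  · exact c _
  · exact h₁
  · exact h₂
  · exact h₃
  · exact n₃
  · exact n₂
  · exact n₁
  · exact c _

/-- A clone of Boolean pattern functions that contains a non-monotone operation contains a Pixley
operation or the minority operation. -/
theorem exists_pixley_or_minority {K : OpClone Bool} (hK : K ≤ patternClone Bool) {n : ℕ+}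
    {f : OpN Bool n} (hf : (⟨n, f⟩ : Operation Bool) ∈ K.carrier) (hmono : ¬ Monotone f) :
    (∃ p : OpN Bool 3, (⟨3, p⟩ : Operation Bool) ∈ K.carrier ∧ IsPixley p) ∨
    ∃ p : OpN Bool 3, (⟨3, p⟩ : Operation Bool) ∈ K.carrier ∧
      ∀ x y z, p ![x, y, z] = (x ^^ y ^^ z) := by
  obtain ⟨u, v, huv, hne⟩ : ∃ u v, u ≤ v ∧ ¬ f u ≤ f v := by
    simpa [Monotone] using hmono
  have hu : f u = true := by
    cases h : f u
    · rw [h] at hne; exact absurd (Bool.false_le _) hne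
    · rfl
  have hv : f v = false := by
    cases h : f v
    · rfl
    · rw [h] at hne; exact absurd (Bool.le_true _) hne
  -- As `u ≤ v`, the pairs (u i, v i) are of three kinds; identifying variables of the same kind
  -- gives a ternary `q`. Its one free value separates Pixley from minority.
  let s : Fin n → Fin 3 := fun i => if u i then 2 else if v i then 1 else 0
  let q : OpN Bool 3 := f.comp fun i => OpN.proj Bool 3 (s i)
  have hq : (⟨3, q⟩ : Operation Bool) ∈ K.carrier := K.comp_mem _ _ _ _ hf fun i => K.proj_mem _ _
  have q₁ : q ![false, false, true] = true := by
    refine (congrArg f (funext fun i => ?_)).trans hu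
    change (![false, false, true] : Fin 3 → Bool) (s i) = u i
    cases hui : u i <;> cases hvi : v i <;> simp [s, hui, hvi]
  have q₃ : q ![false, true, true] = false := by
    refine (congrArg f (funext fun i => ?_)).trans hv
    change (![false, true, true] : Fin 3 → Bool) (s i) = v i
    have := Bool.le_iff_imp.1 (huv i)
    cases hui : u i <;> cases hvi : v i <;> simp_all [s]
  cases q₂ : q ![false, true, false]
  · exact Or.inl ⟨q, hq, isPixley_of_values (hK hq) q₁ q₂ q₃⟩
  · exact Or.inr ⟨q, hq, isMinority_of_values (hK hq) q₁ q₂ q₃⟩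

/-- A clone of Boolean pattern functions that contains the minority operation and a non-linear
operation contains a Pixley operation. -/
theorem exists_pixley_of_minority {K : OpClone Bool} (hK : K ≤ patternClone Bool) {m : OpN Bool 3}
    (hm : (⟨3, m⟩ : Operation Bool) ∈ K.carrier) (hmin : ∀ x y z, m ![x, y, z] = (x ^^ y ^^ z))
    {n : ℕ+} {f : OpN Bool n} (hf : (⟨n, f⟩ : Operation Bool) ∈ K.carrier) {u v : Fin n → Bool}
    (huv : f (fun i => u i ^^ v i) ≠ (f u ^^ f v)) :
    ∃ p : OpN Bool 3, (⟨3, p⟩ : Operation Bool) ∈ K.carrier ∧ IsPixley p := by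
  let pr : Fin 3 → OpN Bool 3 := OpN.proj Bool 3
  have hpr : ∀ i, (⟨3, pr i⟩ : Operation Bool) ∈ K.carrier := K.proj_mem 3
  -- Each `s i` takes the values u i, v i and u i + v i at 001, 010 and 011.
  let s : Fin n → OpN Bool 3 := fun i =>
    if u i then (if v i then m else pr 2) else (if v i then pr 1 else pr 0)
  have hs : ∀ i, (⟨3, s i⟩ : Operation Bool) ∈ K.carrier := by
    intro i
    cases hui : u i <;> cases hvi : v i <;> simp only [s, hui, hvi, if_true] <;>
      first | exact hm | exact hpr _
  let r : OpN Bool 3 := f.comp s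
  have hr : (⟨3, r⟩ : Operation Bool) ∈ K.carrier := K.comp_mem _ _ _ _ hf hs
  have r₁ : r ![false, false, true] = f u := by
    refine congrArg f (funext fun i => ?_)
    cases hui : u i <;> cases hvi : v i <;> simp [s, hui, hvi, hmin, pr, OpN.proj]
  have r₂ : r ![false, true, false] = f v := by
    refine congrArg f (funext fun i => ?_)
    cases hui : u i <;> cases hvi : v i <;> simp [s, hui, hvi, hmin, pr, OpN.proj]
  have r₃ : r ![false, true, true] = f (fun i => u i ^^ v i) := by
    refine congrArg f (funext fun i => ?_)
    cases hui : u i <;> cases hvi : v i <;> simp [s, hui, hvi, hmin, pr, OpN.proj]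
  have hne : r ![false, true, true] ≠ (r ![false, false, true] ^^ r ![false, true, false]) := by
    rw [r₁, r₂, r₃]; exact huv
  clear_value r
  -- At 001, 010, 011 the values of `r` have odd sum, while those of the projections and `m` run
  -- through all triples of even sum. Adding a suitable `w` yields the Pixley triple 1, 0, 0; `pr 0`
  -- vanishes at these points.
  have shift : ∀ w : OpN Bool 3, (⟨3, w⟩ : Operation Bool) ∈ K.carrier →
      (r ![false, false, true] ^^ w ![false, false, true]) = true →
      (r ![false, true, false] ^^ w ![false, true, false]) = false →
      (r ![false, true, true] ^^ w ![false, true, true]) = false →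
      ∃ p : OpN Bool 3, (⟨3, p⟩ : Operation Bool) ∈ K.carrier ∧ IsPixley p := by
    intro w hw h₁ h₂ h₃
    have hp := K.comp_three_mem hm hr hw (hpr 0)
    refine ⟨_, hp, isPixley_of_values (hK hp) ?_ ?_ ?_⟩ <;>
      simp [hmin, pr, OpN.proj, h₁, h₂, h₃]
  cases h₁ : r ![false, false, true] <;> cases h₂ : r ![false, true, false] <;>
    cases h₃ : r ![false, true, true] <;> rw [h₁, h₂, h₃] at hne
  · exact absurd rfl hne
  · exact shift (pr 2) (hpr 2) (by rw [h₁]; rfl) (by rw [h₂]; rfl) (by rw [h₃]; rfl)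
  · exact shift m hm (by rw [h₁, hmin]; rfl) (by rw [h₂, hmin]; rfl) (by rw [h₃, hmin]; rfl)
  · exact absurd rfl hne
  · exact shift (pr 0) (hpr 0) (by rw [h₁]; rfl) (by rw [h₂]; rfl) (by rw [h₃]; rfl)
  · exact absurd rfl hne
  · exact absurd rfl hne
  · exact shift (pr 1) (hpr 1) (by rw [h₁]; rfl) (by rw [h₂]; rfl) (by rw [h₃]; rfl)

/-- A clone of Boolean pattern functions without a Pixley operation consists of monotone
operations or of linear operations. -/
theorem monotone_or_linear {K : OpClone Bool} (hK : K ≤ patternClone Bool)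
    (hpix : ∀ p : OpN Bool 3, (⟨3, p⟩ : Operation Bool) ∈ K.carrier → ¬ IsPixley p) :
    (∀ (n : ℕ+) (f : OpN Bool n), (⟨n, f⟩ : Operation Bool) ∈ K.carrier → Monotone f) ∨
    ∀ (n : ℕ+) (f : OpN Bool n), (⟨n, f⟩ : Operation Bool) ∈ K.carrier →
      ∀ u v, f (fun i => u i ^^ v i) = (f u ^^ f v) := by
  by_contra! hcon
  obtain ⟨⟨n, f, hf, hmono⟩, n', f', hf', u, v, huv⟩ := hcon
  rcases exists_pixley_or_minority hK hf hmono with ⟨p, hp, hpp⟩ | ⟨m, hm, hmin⟩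
  · exact hpix p hp hpp
  · obtain ⟨p, hp, hpp⟩ := exists_pixley_of_minority hK hm hmin hf' huv
    exact hpix p hp hpp

/-- A pattern function on three arguments takes a fixed argument on triples without repetition. -/
theorem IsPattern.exists_index {f : OpN A 3} (hf : IsPattern f) :
    ∃ j : Fin 3, ∀ x y z : A, x ≠ y → y ≠ z → x ≠ z →
      f ![x, y, z] = (![x, y, z] : Fin 3 → A) j := by
  obtain ⟨J, hJ⟩ := hf
  refine ⟨J ⊥, fun x y z hxy hyz hxz => (hJ _).trans ?_⟩
  have hinj : Function.Injective (![x, y, z] : Fin 3 → A) := by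
    intro i k h
    fin_cases i <;> fin_cases k <;> simp_all [eq_comm]
  have : Setoid.ker (![x, y, z] : Fin 3 → A) = ⊥ := by
    ext i k
    exact hinj.eq_iff
  exact congrArg (fun K => (![x, y, z] : Fin 3 → A) (J K)) this

/-- A clone of pattern functions that contains a Pixley operation contains the discriminator. -/
theorem discriminator_mem_of_isPixley {C : OpClone A} {f : OpN A 3} (hpat : IsPattern f)
    (hf : (⟨3, f⟩ : Operation A) ∈ C.carrier) (hpix : IsPixley f) :
    (⟨3, discriminator A⟩ : Operation A) ∈ C.carrier := by
  classical
  have h₀ : ∀ x y, f ![x, x, y] = y := fun x y => (hpix x y).1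
  have h₁ : ∀ x y, f ![x, y, x] = x := fun x y => (hpix x y).2.1
  have h₂ : ∀ x y, f ![x, y, y] = x := fun x y => (hpix x y).2.2
  have pr : ∀ i : Fin 3, (⟨3, OpN.proj A 3 i⟩ : Operation A) ∈ C.carrier := C.proj_mem 3
  have ext3 : ∀ g : OpN A 3, (⟨3, g⟩ : Operation A) ∈ C.carrier →
      (∀ x y z : A, g ![x, y, z] = if x = y then z else x) →
      (⟨3, discriminator A⟩ : Operation A) ∈ C.carrier := by
    intro g hg h
    have : g = discriminator A := by
      funext a
      obtain ⟨x, y, z, rfl⟩ := exists_eq_vec_three a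
      rw [h, discriminator_apply]
    exact this ▸ hg
  have hrev := C.comp_three_mem hf (pr 2) (pr 1) (pr 0)
  -- The Pixley identities settle triples with a repetition; `j` is the choice on the others. The
  -- discriminator is f(x,y,z), f(f(z,y,x),y,x) or f(z,y,x) for `j` = 0, 1, 2.
  obtain ⟨j, hj⟩ := hpat.exists_index
  fin_cases j
  · refine ext3 _ hf fun x y z => ?_
    by_cases hxy : x = y
    · subst hxy; simp [h₀]
    by_cases hyz : y = z
    · subst hyz; simp [h₂, hxy]
    by_cases hxz : x = z
    · subst hxz; simp [h₁, hxy]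
    simp [hj x y z hxy hyz hxz, hxy]
  · refine ext3 _ (C.comp_three_mem hf hrev (pr 1) (pr 0)) fun x y z => ?_
    simp only [OpN.proj, Matrix.cons_val]
    by_cases hxy : x = y
    · subst hxy; simp [h₂]
    by_cases hyz : y = z
    · subst hyz; simp [h₀, h₁, hxy]
    by_cases hxz : x = z
    · subst hxz; simp [h₁, hxy]
    simp [hj z y x (Ne.symm hyz) (Ne.symm hxy) (Ne.symm hxz), hxy, h₀]
  · refine ext3 _ hrev fun x y z => ?_
    simp only [OpN.proj, Matrix.cons_val]
    by_cases hxy : x = y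
    · subst hxy; simp [h₂]
    by_cases hyz : y = z
    · subst hyz; simp [h₀, hxy]
    by_cases hxz : x = z
    · subst hxz; simp [h₁, hxy]
    simp [hj z y x (Ne.symm hyz) (Ne.symm hxy) (Ne.symm hxz), hxy]

/-- Each Pixley identity involves only two elements, so it lifts from `Bool` to `A`. -/
theorem not_isPixley_of_lt {H : OpClone A} (hH : H < discriminatorClone A)
    {p : OpN Bool 3} (hp : (⟨3, p⟩ : Operation Bool) ∈ (restrictBool H).carrier) :
    ¬ IsPixley p := by
  intro hpix
  obtain ⟨f, hf, hfe⟩ := hp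
  have hpat : IsPattern f := discriminatorClone_le_patternClone (hH.le hf)
  refine hH.not_ge (discriminatorClone_le (discriminator_mem_of_isPixley hpat hf fun x y => ?_))
  by_cases hxy : x = y
  · subst hxy
    exact ⟨hpat.map_vec_const x, hpat.map_vec_const x, hpat.map_vec_const x⟩
  · let e : Bool → A := fun b => cond b y x
    have he : Function.Injective e := by
      rintro (_ | _) (_ | _) h <;> simp_all [e, eq_comm]
    have key : ∀ b₀ b₁ b₂ : Bool, f ![e b₀, e b₁, e b₂] = e (p ![b₀, b₁, b₂]) := fun b₀ b₁ b₂ =>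
      (congrArg f (comp_vec_three e b₀ b₁ b₂).symm).trans (hfe e he _)
    obtain ⟨p₀, p₁, p₂⟩ := hpix false true
    refine ⟨(key false false true).trans ?_, (key false true false).trans ?_,
      (key false true true).trans ?_⟩
    · rw [p₀]; rfl
    · rw [p₁]; rfl
    · rw [p₂]; rfl

/-- If a clone induces only monotone operations on two-element subsets, then it has infinitely many
classes: parity functions are not minors of operations of smaller arity. -/
theorem infinite_classes_of_monotone [Nontrivial A] {H : OpClone A} (hH : H ≤ patternClone A)
    (hmono : ∀ (n : ℕ+) (f : OpN Bool n),
      (⟨n, f⟩ : Operation Bool) ∈ (restrictBool H).carrier → Monotone f) :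
    Infinite H.Classes := by
  classical
  obtain ⟨x, y, hxy⟩ := exists_pair_ne A
  let e : Bool → A := fun b => cond b y x
  have he : Function.Injective e := by
    rintro (_ | _) (_ | _) h <;> simp_all [e, eq_comm]
  refine OpClone.infinite_classes_of_arity fun N => ?_
  let n : ℕ+ := N.succPNat
  refine ⟨⟨n, fun a => e (decide (Even (Finset.univ.filter fun i => a i = e true).card))⟩, ?_⟩
  rintro ⟨m, g⟩ ⟨h, hh, hfg⟩
  change Fin m → OpN A n at h
  change (fun a => _) = (fun a => g fun i => h i a) at hfg
  choose u hu hue using fun i => exists_mem_restrictBool hH (hh i)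
  let c : ℕ → Fin n → Bool := fun k i => decide ((i : ℕ) < k)
  have hcard : ∀ k ≤ N + 1, (Finset.univ.filter fun i => (e ∘ c k) i = e true).card = k := by
    intro k hk
    have : (Finset.univ.filter fun i : Fin n => (e ∘ c k) i = e true) =
        Finset.univ.filter fun i : Fin n => (i : ℕ) < k := by
      ext i; simp [he.eq_iff, c]
    have hn : (n : ℕ) = N + 1 := rfl
    rw [this, Fin.card_filter_val_lt, hn]
    omega
  -- Parity changes at every step of the chain `c`, so the inner operations must tell neighbours
  -- apart.
  have hstep : ∀ k, k < N + 1 → (fun i => u i (c k)) ≠ fun i => u i (c (k + 1)) := by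
    intro k hk heq
    have h₁ := congrFun hfg (e ∘ c k)
    have h₂ := congrFun hfg (e ∘ c (k + 1))
    have h₃ : (fun i => h i (e ∘ c k)) = fun i => h i (e ∘ c (k + 1)) := by
      funext i
      rw [hue i e he, hue i e he]
      exact congrArg e (congrFun heq i)
    simp only at h₁ h₂
    rw [hcard k hk.le] at h₁
    rw [hcard (k + 1) hk] at h₂
    rw [h₃, ← h₂] at h₁
    have := he h₁
    rw [decide_eq_decide, Nat.even_add_one] at this
    exact iff_not_self this
  have hle : ∀ k i, u i (c k) ≤ u i (c (k + 1)) := fun k i =>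
    hmono _ _ (hu i) fun j => by
      refine Bool.le_iff_imp.2 fun hj => ?_
      simp only [c, decide_eq_true_eq] at hj ⊢
      omega
  have hgrow : ∀ k ≤ N + 1, k ≤ (Finset.univ.filter fun i => u i (c k) = true).card := by
    intro k
    induction k with
    | zero => simp
    | succ k ih =>
      intro hk
      refine Nat.lt_of_le_of_lt (ih (by omega)) (Finset.card_lt_card ?_)
      rw [Finset.ssubset_iff_of_subset]
      · obtain ⟨i, hi⟩ := Function.ne_iff.1 (hstep k hk)
        have := Bool.le_iff_imp.1 (hle k i)
        refine ⟨i, ?_, ?_⟩ <;> cases h₁ : u i (c k) <;> cases h₂ : u i (c (k + 1)) <;> simp_all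
      · intro i hi
        have := Bool.le_iff_imp.1 (hle k i)
        cases h₂ : u i (c (k + 1)) <;> simp_all
  have h₁ := hgrow (N + 1) le_rfl
  have h₂ := Finset.card_le_univ (Finset.univ.filter fun i => u i (c (N + 1)) = true)
  rw [Fintype.card_fin] at h₂
  exact Nat.lt_of_succ_le (h₁.trans h₂)

/-- If a clone induces only linear operations on two-element subsets, then it has infinitely many
classes: conjunctions are not minors of operations of smaller arity. -/
theorem infinite_classes_of_linear [Nontrivial A] {H : OpClone A} (hH : H ≤ patternClone A)
    (hlin : ∀ (n : ℕ+) (f : OpN Bool n),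
      (⟨n, f⟩ : Operation Bool) ∈ (restrictBool H).carrier →
        ∀ u v, f (fun i => u i ^^ v i) = (f u ^^ f v)) :
    Infinite H.Classes := by
  classical
  obtain ⟨x, y, hxy⟩ := exists_pair_ne A
  let e : Bool → A := fun b => cond b y x
  have he : Function.Injective e := by
    rintro (_ | _) (_ | _) h <;> simp_all [e, eq_comm]
  refine OpClone.infinite_classes_of_arity fun N => ?_
  let n : ℕ+ := N.succPNat
  refine ⟨⟨n, fun a => e (decide (∀ i, a i = e true))⟩, ?_⟩
  rintro ⟨m, g⟩ ⟨h, hh, hfg⟩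
  change Fin m → OpN A n at h
  change (fun a => _) = (fun a => g fun i => h i a) at hfg
  choose u hu hue using fun i => exists_mem_restrictBool hH (hh i)
  by_contra hlt
  have hnot : ¬ Function.Injective fun (b : Fin n → Bool) i => u i b := by
    intro hinj
    have := Fintype.card_le_of_injective _ hinj
    simp only [Fintype.card_pi, Fintype.card_bool, Finset.prod_const, Finset.card_univ,
      Fintype.card_fin] at this
    have h₁ := (Nat.pow_le_pow_iff_right (by norm_num)).1 this
    exact hlt h₁
  simp only [Function.Injective, not_forall] at hnot
  obtain ⟨b, b', hbb, hne⟩ := hnot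
  -- The sum of the colliding tuples is a nonzero kernel vector; adding it to the all-true tuple
  -- changes the conjunction but no `u i`.
  let w : Fin n → Bool := fun i => true ^^ (b i ^^ b' i)
  have hw : ∀ i, u i w = u i fun _ => true := by
    intro i
    have hbi : u i b = u i b' := congrFun hbb i
    have hz : u i (fun j => b j ^^ b' j) = false := by
      rw [hlin _ _ (hu i) b b', hbi, Bool.xor_self]
    rw [hlin _ _ (hu i) (fun _ => true) (fun j => b j ^^ b' j), hz, Bool.xor_false]
  have h₁ := congrFun hfg (e ∘ w)
  have h₂ := congrFun hfg (e ∘ fun _ => true)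
  have h₃ : (fun i => h i (e ∘ w)) = fun i => h i (e ∘ fun _ => true) := by
    funext i
    rw [hue i e he, hue i e he, hw]
  rw [h₃, ← h₂] at h₁
  have h₄ := he h₁
  have h₅ : ∀ i, w i = true := by
    simpa [he.eq_iff] using h₄
  exact hne (funext fun i => by simpa [w] using h₅ i)

theorem infinite_classes_of_lt_discriminatorClone [Nontrivial A] {H : OpClone A}
    (hH : H < discriminatorClone A) : Infinite H.Classes := by
  have hpat : H ≤ patternClone A := hH.le.trans discriminatorClone_le_patternClone
  rcases monotone_or_linear (restrictBool_le_patternClone hpat)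
    (fun p hp => not_isPixley_of_lt hH hp) with h | h
  · exact infinite_classes_of_monotone hpat h
  · exact infinite_classes_of_linear hpat h

end TwoElements

/-! ### Słupecki's clone and Jablonskii's lemmas -/

section Slupecki

variable {A : Type*}

/-- An operation depends on at most one of its variables. -/
def IsEssentiallyUnary {n : ℕ+} (f : OpN A n) : Prop :=
  ∃ (φ : A → A) (i : Fin n), ∀ a, f a = φ (a i)

/-- Słupecki's clone: the operations that are essentially unary or not surjective. -/
def slupeckiClone (A : Type*) [Finite A] : OpClone A where
  carrier := {f | IsEssentiallyUnary f.2 ∨ ¬ Function.Surjective f.2}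
  proj_mem := fun n i => Or.inl ⟨id, i, fun _ => rfl⟩
  comp_mem := by
    rintro m n g h (⟨φ, i, hg⟩ | hg) hh
    · have hgh : ∀ a, (g.comp h) a = φ (h i a) := fun a => hg _
      rcases hh i with ⟨ψ, j, hi⟩ | hi
      · exact Or.inl ⟨φ ∘ ψ, j, fun a => (hgh a).trans (congrArg φ (hi a))⟩
      · refine Or.inr fun hs => hi ?_
        have hs' : Function.Surjective (φ ∘ h i) := by
          intro b
          obtain ⟨a, ha⟩ := hs b
          exact ⟨a, (hgh a).symm.trans ha⟩
        have hφ : Function.Injective φ := Finite.injective_iff_surjective.2 hs'.of_comp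
        intro b
        obtain ⟨a, ha⟩ := hs' (φ b)
        exact ⟨a, hφ ha⟩
    · exact Or.inr fun hs => hg fun b => by
        obtain ⟨a, ha⟩ := hs b
        exact ⟨_, ha⟩

/-- Main lemma of Jablonskii: an operation with at least three values that is not essentially unary
takes three different values on three tuples, two of which differ in one variable only, while this
variable has the same value in the third tuple and in one of the first two. -/
theorem exists_three_values {n : ℕ+} {f : OpN A n} (hf : ¬ IsEssentiallyUnary f)
    (h3 : ∀ x y : A, ∃ a, f a ≠ x ∧ f a ≠ y) :
    ∃ (i : Fin n) (a b c : Fin n → A), (∀ j, j ≠ i → a j = b j) ∧ a i = c i ∧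
      f a ≠ f b ∧ f a ≠ f c ∧ f b ≠ f c := by
  classical
  have hnc : ∃ (i : Fin n) (a : Fin n → A) (β : A), f (Function.update a i β) ≠ f a := by
    by_contra! hcon
    have hconst : ∀ (S : Finset (Fin n)) (a b : Fin n → A), f (S.piecewise a b) = f b := by
      intro S a b
      induction S using Finset.induction_on with
      | empty => simp
      | insert i S hi ih => rw [Finset.piecewise_insert, hcon, ih]
    rcases isEmpty_or_nonempty A with hA | ⟨⟨x⟩⟩
    · exact hf ⟨id, ⟨0, n.pos⟩, fun a => hA.elim (f a)⟩
    exact hf ⟨fun _ => f fun _ => x, ⟨0, n.pos⟩, fun b => by simpa using hconst Finset.univ b fun _ => x⟩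
  obtain ⟨i, a₀, β₀, h₀⟩ := hnc
  -- Is there a line in direction `i` on which `f` is nonconstant yet misses a value f c? If so,
  -- take the point of that line over `c i` and a second point with another value.
  by_cases hmiss : ∃ (a : Fin n → A) (β : A), f (Function.update a i β) ≠ f a ∧
      ∃ v ∈ Set.range f, ∀ γ, f (Function.update a i γ) ≠ v
  · obtain ⟨a, β, hne, -, ⟨c, rfl⟩, hv⟩ := hmiss
    have hex : ∃ γ, f (Function.update a i γ) ≠ f (Function.update a i (c i)) := by
      by_contra! hall
      exact hne ((hall β).trans ((hall (a i)).symm.trans (by simp)))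
    obtain ⟨γ, hγ⟩ := hex
    refine ⟨i, Function.update a i (c i), Function.update a i γ, c, fun j hj => ?_, by simp,
      hγ.symm, hv _, hv _⟩
    simp [hj]
  · push Not at hmiss
    by_cases hdiff : ∃ (a c : Fin n → A) (β : A), f (Function.update a i β) ≠ f a ∧ a i = c i ∧
        f a ≠ f c
    · obtain ⟨a, c, β, hne, hac, hfac⟩ := hdiff
      obtain ⟨d, hd₁, hd₂⟩ := h3 (f a) (f c)
      obtain ⟨γ, hγ⟩ := hmiss a β hne (f d) ⟨d, rfl⟩
      refine ⟨i, a, Function.update a i γ, c, fun j hj => by simp [hj], hac, ?_, hfac, ?_⟩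
      · rw [hγ]; exact hd₁.symm
      · rw [hγ]; exact hd₂
    -- Now the value at any point of a nonconstant line depends only on its `i`-th coordinate, for
    -- all of `f`; so `f` is essentially unary.
    · push Not at hdiff
      refine absurd ⟨fun x => f (Function.update a₀ i x), i, fun c => ?_⟩ hf
      have hex : ∃ γ, f (Function.update a₀ i γ) ≠ f (Function.update a₀ i (c i)) := by
        by_contra! hall
        exact h₀ ((hall β₀).trans ((hall (a₀ i)).symm.trans (by simp)))
      obtain ⟨γ, hγ⟩ := hex
      exact (hdiff (Function.update a₀ i (c i)) c γ (by simpa using hγ) (by simp)).symm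

/-- Fundamental lemma of Jablonskii: an operation that is not essentially unary takes all its values
on a product of proper subsets. -/
theorem exists_box [Finite A] (hA : 2 < Nat.card A) {n : ℕ+} {f : OpN A n}
    (hf : ¬ IsEssentiallyUnary f) :
    ∃ (ω : Fin n → A), ∀ y ∈ Set.range f, ∃ a, f a = y ∧ ∀ j, a j ≠ ω j := by
  classical
  have := Fintype.ofFinite A
  rw [Nat.card_eq_fintype_card] at hA
  suffices hS : ∃ S : Finset (Fin n → A), (∀ y ∈ Set.range f, ∃ a ∈ S, f a = y) ∧
      ∀ j, (S.image fun a => a j).card < Fintype.card A by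
    obtain ⟨S, hS, hcard⟩ := hS
    have hω : ∀ j, ∃ w, w ∉ S.image fun a => a j := fun j => by
      by_contra! hall
      exact (hcard j).ne (Finset.card_eq_iff_eq_univ _ |>.2 (Finset.eq_univ_iff_forall.2 hall))
    choose ω hω using hω
    refine ⟨ω, fun y hy => ?_⟩
    obtain ⟨a, ha, hay⟩ := hS y hy
    exact ⟨a, hay, fun j hj => hω j (hj ▸ Finset.mem_image_of_mem _ ha)⟩
  by_cases hsurj : Function.Surjective f
  · obtain ⟨i, a, b, c, hab, hac, h₁, h₂, h₃⟩ := exists_three_values hf fun x y => by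
      obtain ⟨z, hz⟩ : ∃ z, z ∉ ({x, y} : Finset A) := by
        by_contra! hall
        have := Finset.card_le_card (fun z _ => hall z : (Finset.univ : Finset A) ⊆ {x, y})
        have := Finset.card_le_two (a := x) (b := y)
        rw [Finset.card_univ] at *
        omega
      obtain ⟨d, rfl⟩ := hsurj z
      exact ⟨d, by simpa using hz⟩
    choose s hs using hsurj
    let T : Finset A := {f a, f b, f c}
    have hT : T.card = 3 := Finset.card_eq_three.2 ⟨_, _, _, h₁, h₂, h₃, rfl⟩
    have hTc : (Tᶜ.image s).card + 3 ≤ Fintype.card A := by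
      have h₄ := Finset.card_image_le (s := Tᶜ) (f := s)
      have h₅ := Finset.card_compl_add_card T
      omega
    -- Three values are attained using at most two entries per coordinate; the other |A| - 3 values
    -- cost one entry each, leaving at least one element unused.
    refine ⟨{a, b, c} ∪ Tᶜ.image s, fun y _ => ?_, fun j => ?_⟩
    · by_cases hy : y ∈ T
      · simp only [T, Finset.mem_insert, Finset.mem_singleton] at hy
        rcases hy with rfl | rfl | rfl
        · exact ⟨a, by simp, rfl⟩
        · exact ⟨b, by simp, rfl⟩
        · exact ⟨c, by simp, rfl⟩
      · exact ⟨s y, Finset.mem_union_right _ (Finset.mem_image_of_mem _ (by simpa using hy)), hs y⟩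
    · have htwo : (({a, b, c} : Finset (Fin n → A)).image fun d => d j).card ≤ 2 := by
        by_cases hj : j = i
        · subst hj
          simpa [hac] using Finset.card_le_two (a := b j) (b := c j)
        · simpa [hab j hj] using Finset.card_le_two (a := b j) (b := c j)
      rw [Finset.image_union]
      have h₄ := Finset.card_union_le (({a, b, c} : Finset (Fin n → A)).image fun d => d j)
        ((Tᶜ.image s).image fun d => d j)
      have h₅ := Finset.card_image_le (s := Tᶜ.image s) (f := fun d => d j)
      omega
  · let R : Finset A := Finset.univ.filter (· ∈ Set.range f)
    have hR : R.card < Fintype.card A := by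
      rw [← Finset.card_univ]
      refine Finset.card_lt_card (Finset.ssubset_univ_iff.2 fun h => hsurj fun y => ?_)
      have : y ∈ R := h ▸ Finset.mem_univ y
      simpa [R] using this
    let s : A → Fin n → A := fun y => if h : ∃ a, f a = y then h.choose else fun _ => y
    have hs : ∀ y ∈ Set.range f, f (s y) = y := fun y hy => by
      have hy' : ∃ a, f a = y := hy
      simp only [s, dif_pos hy']
      exact hy'.choose_spec
    refine ⟨R.image s, fun y hy => ⟨s y, Finset.mem_image_of_mem _ (by simpa [R] using hy), hs y hy⟩,
      fun j => ?_⟩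
    exact (Finset.card_image_le.trans Finset.card_image_le).trans_lt hR

/-- Outside the essentially unary case only the range matters: preimages chosen in the box of
`exists_box` have coordinate functions that miss `ω i`, hence lie in the clone. -/
theorem slupeckiClone_mem_finiteIndex [Finite A] (hA : 2 < Nat.card A) :
    slupeckiClone A ∈ OpClone.finiteIndex A := by
  refine OpClone.finite_classes_of_invariant (β := Set (A → A) × Set A)
    (fun f => ({φ | ∃ i, ∀ a, f.2 a = φ (a i)}, Set.range f.2)) ?_
  rintro ⟨n, f⟩ ⟨m, g⟩ hfg
  obtain ⟨hun, hran⟩ := Prod.mk.inj hfg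
  change {φ : A → A | ∃ i, ∀ a, f a = φ (a i)} = {φ : A → A | ∃ i, ∀ a, g a = φ (a i)} at hun
  change Set.range f = Set.range g at hran
  by_cases hf : IsEssentiallyUnary f
  · obtain ⟨φ, i, hφ⟩ := hf
    obtain ⟨j, hj⟩ := hun.subset ⟨i, hφ⟩
    exact ⟨fun _ => OpN.proj A n i, fun _ => OpClone.proj_mem _ _ _,
      funext fun a => (hφ a).trans (hj fun _ => a i).symm⟩
  · have hg : ¬ IsEssentiallyUnary g := by
      rintro ⟨φ, i, hφ⟩
      obtain ⟨j, hj⟩ := hun.superset ⟨i, hφ⟩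
      exact hf ⟨φ, j, hj⟩
    obtain ⟨ω, hω⟩ := exists_box hA hg
    choose b hb hbω using fun a => hω (f a) (hran.subset ⟨a, rfl⟩)
    refine ⟨fun i a => b a i, fun i => Or.inr fun hs => ?_, funext fun a => (hb a).symm⟩
    obtain ⟨a, ha⟩ := hs (ω i)
    exact hbω a i ha

theorem discriminator_notMem_slupeckiClone [Finite A] [Nontrivial A] :
    (⟨3, discriminator A⟩ : Operation A) ∉ (slupeckiClone A).carrier := by
  classical
  have hd := discriminator_apply (A := A)
  rintro (⟨φ, i, hφ⟩ | hs)
  · obtain ⟨x, y, hxy⟩ := exists_pair_ne A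
    have hφ' : ∀ a b c : A, (if a = b then c else a) = φ ((![a, b, c] : Fin 3 → A) i) :=
      fun a b c => (hd a b c).symm.trans (hφ _)
    have hid : ∀ a, φ a = a := fun a => by
      have := hφ' a a a
      rw [vec_three_const] at this
      simpa using this.symm
    have h₁ := hφ' x x y
    have h₂ := hφ' x y y
    rw [hid] at h₁ h₂
    change Fin 3 at i
    fin_cases i
    · exact hxy (by simpa using h₁.symm)
    · exact hxy (by simpa using h₁.symm)
    · simp [hxy] at h₂
  · exact hs fun x => ⟨![x, x, x], (hd x x x).trans (by simp)⟩

end Slupecki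

theorem theorem4p4 {A : Type*} [Finite A] (hA : 2 < Nat.card A) :
    (∀ H : OpClone A, H < discriminatorClone A → Infinite H.Classes) ∧
    IsUpperSet (OpClone.finiteIndex A) ∧
    Minimal (fun C : OpClone A => C ∈ OpClone.finiteIndex A) (discriminatorClone A) ∧
    ¬ ∃ C : OpClone A, OpClone.finiteIndex A = Set.Ici C := by
  have : Nontrivial A := Finite.one_lt_card_iff_nontrivial.1 (by omega)
  have hinf : ∀ H : OpClone A, H < discriminatorClone A → Infinite H.Classes :=
    fun H hH => infinite_classes_of_lt_discriminatorClone hH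
  have hmin : ∀ C ∈ OpClone.finiteIndex A, C ≤ discriminatorClone A → discriminatorClone A ≤ C := by
    intro C (hC : Finite C.Classes) hle
    by_contra hnle
    exact not_finite_iff_infinite.2 (hinf C (lt_of_le_not_ge hle hnle)) hC
  refine ⟨hinf, OpClone.isUpperSet_finiteIndex, ⟨discriminatorClone_mem_finiteIndex, hmin⟩, ?_⟩
  rintro ⟨C, hC⟩
  have hCD : C ≤ discriminatorClone A := hC.subset discriminatorClone_mem_finiteIndex
  have hCF : C ∈ OpClone.finiteIndex A := hC.superset (Set.mem_Ici.2 le_rfl)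
  have hCS : C ≤ slupeckiClone A := hC.subset (slupeckiClone_mem_finiteIndex hA)
  exact discriminator_notMem_slupeckiClone
    (hCS (hmin C hCF hCD discriminator_mem_discriminatorClone))
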